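/- Let $Q_n$ be the $n$-dimensional hypercube: its vertices are the $n$-bit binary strings, two of them being adjacent if and only if they differ in exactly one bit. In particular $Q_1\cong K_2$. For a connected graph $G$ and a graph $W$, a $W$-structure of $G$ is a subgraph of $G$ isomorphic to $W$, and a $W$-substructure of $G$ is a subgraph of $G$ isomorphic to a connected nonempty subgraph of $W$. (For $W=Q_1$ these are the edges, respectively the single vertices and the edges, of $G$.) Removing a set of subgraphs means deleting all their vertices. Let $\kappa(G;W)$ (respectively $\kappa^s(G;W)$) be the least cardinality of a set of pairwise vertex-disjoint $W$-structures (respectively $W$-substructures) of $G$ whose removal disconnects $G$, and let $D_f(G;W)$ (respectively $D_f^s(G;W)$) be the maximum diameter of a graph obtained from $G$ by removing at most $\kappa(G;W)-1$ pairwise vertex-disjoint $W$-structures (respectively at most $\kappa^s(G;W)-1$ pairwise vertex-disjoint $W$-substructures). **Theorem 3.7.** For $n\ge 3$ one has $\kappa(Q_n;Q_1)=\kappa^s(Q_n;Q_1)=n-1$, so that at most $n-2$ structures or substructures are removed in the definition of the fault diameters, and $$D_f^s(Q_3;Q_1)=D_f(Q_3;Q_1)=3,\qquad D_f^s(Q_n;Q_1)=D_f(Q_n;Q_1)=n+1\quad\text{for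 all } n\ge 4 .$$ -/

import Mathlib

/-- The `n`-dimensional hypercube `Q_n`: vertices are the `n`-bit strings, and two strings are
adjacent when they differ in exactly one position. -/
def hypercube (n : ℕ) : SimpleGraph (Fin n → Bool) where
  Adj x y := hammingDist x y = 1
  symm := ⟨fun x y h => by rw [hammingDist_comm]; exact h⟩
  loopless := ⟨fun x h => by simp at h⟩

namespace SimpleGraph

variable {V : Type*} {U : Type*}

/-- A `W`-structure of `G`: a subgraph of `G` isomorphic to `W`. -/
def IsStructure (W : SimpleGraph U) {G : SimpleGraph V} (H : G.Subgraph) : Prop :=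
  Nonempty (H.coe ≃g W)

/-- A `W`-substructure of `G`: a subgraph of `G` isomorphic to a connected (in particular
nonempty) subgraph of `W`. -/
def IsSubstructure (W : SimpleGraph U) {G : SimpleGraph V} (H : G.Subgraph) : Prop :=
  ∃ W' : W.Subgraph, W'.Connected ∧ Nonempty (H.coe ≃g W'.coe)

/-- A finite set of pairwise vertex-disjoint subgraphs of `G`, each of them satisfying `P`. -/
def IsFaultFamily {G : SimpleGraph V} (P : G.Subgraph → Prop) (F : Finset G.Subgraph) : Prop :=
  (∀ H ∈ F, P H) ∧ (F : Set G.Subgraph).Pairwise fun H K => Disjoint H.verts K.verts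

/-- The vertices of `G` that lie in no member of `F`. -/
def survivors {G : SimpleGraph V} (F : Finset G.Subgraph) : Set V :=
  {v | ∀ H ∈ F, v ∉ H.verts}

/-- The graph `G - F`, obtained from `G` by deleting all vertices of all members of `F`. -/
def removeFamily (G : SimpleGraph V) (F : Finset G.Subgraph) : SimpleGraph (survivors F) :=
  G.induce (survivors F)

/-- The least cardinality of a set of vertex-disjoint subgraphs satisfying `P` whose removal
disconnects `G`, that is, leaves two vertices not joined by a path (`⊤` if there is none). -/
noncomputable def faultConnectivity (G : SimpleGraph V) (P : G.Subgraph → Prop) : ℕ∞ :=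
  sInf {k | ∃ F : Finset G.Subgraph,
    IsFaultFamily P F ∧ ¬ (G.removeFamily F).Preconnected ∧ k = (F.card : ℕ∞)}

/-- The largest diameter of a graph obtained from `G` by removing at most
`faultConnectivity G P - 1` vertex-disjoint subgraphs satisfying `P`. The diameter is the extended
one, which is `⊤` for a disconnected graph; in particular a finite supremum is attained. -/
noncomputable def faultDiameter (G : SimpleGraph V) (P : G.Subgraph → Prop) : ℕ∞ :=
  sSup {d | ∃ F : Finset G.Subgraph, IsFaultFamily P F ∧
    (F.card : ℕ∞) ≤ faultConnectivity G P - 1 ∧ d = (G.removeFamily F).ediam}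

/-- The `W`-structure connectivity `κ(G; W)`. -/
noncomputable def structureConnectivity (G : SimpleGraph V) (W : SimpleGraph U) : ℕ∞ :=
  faultConnectivity G (IsStructure W)

/-- The `W`-substructure connectivity `κˢ(G; W)`. -/
noncomputable def substructureConnectivity (G : SimpleGraph V) (W : SimpleGraph U) : ℕ∞ :=
  faultConnectivity G (IsSubstructure W)

/-- The `W`-structure fault diameter `D_f(G; W)`. -/
noncomputable def structureFaultDiameter (G : SimpleGraph V) (W : SimpleGraph U) : ℕ∞ :=
  faultDiameter G (IsStructure W)

/-- The `W`-substructure fault diameter `D_fˢ(G; W)`. -/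
noncomputable def substructureFaultDiameter (G : SimpleGraph V) (W : SimpleGraph U) : ℕ∞ :=
  faultDiameter G (IsSubstructure W)

end SimpleGraph

/-! The upper bounds use one property of a fault: its vertices are pairwise equal or adjacent, so no
two of them differ in two coordinates. Let u, v be survivors at Hamming distance d, and count the
faults meeting the subcube they span. If there are at most d - 2, some step towards v keeps alive
and discards a fault from the remaining subcube, so by induction a shortest path survives
(`exists_step`, `edist_le_hammingDist`). Otherwise, for d ≥ 2, at most n - d - 1 faults miss the
subcube, so one of its n - d translates is met only by faults that also meet the subcube. Such
faults meet the translate in single vertices, and double counting (`exists_translate`) finds a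
translate with at most d - 1 of them, through which a path of length d + 2 runs. Antipodal pairs are
in the first case, so the diameter is at most n + 1; being finite, it also gives the lower bound on
connectivity. For n = 3, pairs at distance 2 keep their distance.

For sharpness, delete parallel edges in direction o at the neighbours of the origin. All n - 1 of
them cut off the edge at the origin; sparing direction l leaves l as the only way out, and the
antipode of the l-th unit string is then at distance at least n + 1 from the origin. For n = 3 that
antipode is itself deleted. -/

open SimpleGraph

/-- The bit string `u` with its `i`-th bit flipped. -/
def bitFlip {n : ℕ} (u : Fin n → Bool) (i : Fin n) : Fin n → Bool :=
  Function.update u i (!u i)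

/-- The smallest subcube containing the bit strings `u` and `v`. -/
def subcube {n : ℕ} (u v : Fin n → Bool) : Set (Fin n → Bool) :=
  {w | ∀ i, u i = v i → w i = u i}

open Classical in
/-- The members of the family `F` that meet the subcube spanned by `u` and `v`. -/
noncomputable def faultsMeeting {n : ℕ} (F : Finset (hypercube n).Subgraph)
    (u v : Fin n → Bool) : Finset (hypercube n).Subgraph :=
  F.filter fun H => ∃ w ∈ H.verts, w ∈ subcube u v

/-- Any two vertices of a member of `F` are equal or adjacent. -/
def IsCliqueFamily {n : ℕ} (F : Finset (hypercube n).Subgraph) : Prop :=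
  ∀ H ∈ F, ∀ x ∈ H.verts, ∀ y ∈ H.verts, hammingDist x y ≤ 1

/-! ### Bit flips, Hamming distance and subcubes. -/

section bits

variable {n : ℕ} {u v w x y : Fin n → Bool} {i j : Fin n}

@[simp] lemma bitFlip_self : bitFlip u i i = !u i := by simp [bitFlip]

lemma bitFlip_of_ne (h : j ≠ i) : bitFlip u i j = u j := by simp [bitFlip, h]

lemma bitFlip_apply : bitFlip u i j = if j = i then !u i else u j := by
  by_cases h : j = i
  · subst h; simp
  · simp [h, bitFlip_of_ne]

lemma hammingDist_bitFlip : hammingDist u (bitFlip u i) = 1 := by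
  rw [hammingDist, Finset.card_eq_one]
  refine ⟨i, ?_⟩
  ext j
  by_cases h : j = i <;> simp [bitFlip_apply, h]

lemma eq_of_hammingDist_le_one (h : hammingDist x y ≤ 1) (hi : x i ≠ y i) (hj : x j ≠ y j) :
    i = j :=
  Finset.card_le_one.1 h i (by simp [hi]) j (by simp [hj])

lemma exists_eq_bitFlip (h : hammingDist u v = 1) : ∃ i, v = bitFlip u i := by
  rw [hammingDist, Finset.card_eq_one] at h
  obtain ⟨i, hi⟩ := h
  refine ⟨i, funext fun j => ?_⟩
  have := Finset.ext_iff.1 hi j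
  simp only [Finset.mem_filter, Finset.mem_univ, true_and, Finset.mem_singleton] at this
  by_cases hj : j = i
  · subst hj; simp at this; grind [bitFlip_self]
  · grind [bitFlip_of_ne]

lemma hammingDist_bitFlip_of_ne (h : u i ≠ v i) :
    hammingDist (bitFlip u i) v + 1 = hammingDist u v := by
  simp only [hammingDist]
  rw [← Finset.card_erase_add_one (s := Finset.univ.filter fun j => u j ≠ v j) (a := i)
    (by simp [h])]
  congr 2
  ext j
  by_cases hj : j = i
  · subst hj; simp; grind
  · simp [hj, bitFlip_apply]

lemma hammingDist_bitFlip_bitFlip : hammingDist (bitFlip u i) (bitFlip v i) = hammingDist u v := by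
  simp only [hammingDist]
  congr 1
  ext j
  by_cases hj : j = i
  · subst hj; simp
  · simp [hj, bitFlip_apply]

lemma left_mem_subcube : u ∈ subcube u v := fun _ _ => rfl

lemma subcube_bitFlip_subset (h : u i ≠ v i) : subcube (bitFlip u i) v ⊆ subcube u v := by
  intro w hw j hj
  have hji : j ≠ i := by rintro rfl; exact h hj
  have := hw j
  rw [bitFlip_of_ne hji] at this
  exact this hj

lemma mem_subcube_bitFlip (h : u i ≠ v i) :
    w ∈ subcube (bitFlip u i) v ↔ w ∈ subcube u v ∧ w i = v i := by
  refine ⟨fun hw => ⟨subcube_bitFlip_subset h hw, ?_⟩, fun hw j hj => ?_⟩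
  · have := hw i
    grind [bitFlip_self]
  · by_cases hji : j = i
    · subst hji; rw [hw.2, hj]
    · rw [bitFlip_of_ne hji] at hj ⊢
      exact hw.1 j hj

/-- Stated through `u` alone, so that translates in different directions can be compared
coordinatewise. -/
lemma mem_subcube_bitFlip_bitFlip (h : u i = v i) :
    w ∈ subcube (bitFlip u i) (bitFlip v i) ↔
      w i ≠ u i ∧ ∀ j, j ≠ i → u j = v j → w j = u j := by
  constructor
  · intro hw
    refine ⟨?_, fun j hj huv => ?_⟩
    · have := hw i
      grind [bitFlip_self]
    · have := hw j
      grind [bitFlip_of_ne]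
  · rintro ⟨h1, h2⟩ j hj
    by_cases hji : j = i
    · subst hji; rw [bitFlip_self]; cases h' : w j <;> cases h'' : u j <;> simp_all
    · rw [bitFlip_of_ne hji] at hj ⊢
      exact h2 j hji (by rwa [bitFlip_of_ne hji] at hj)

lemma bitFlip_mem_subcube (h : u i ≠ v i) : bitFlip u i ∈ subcube u v := by
  intro j hj
  exact bitFlip_of_ne (by rintro rfl; exact h hj)

end bits

/-! ### Shortest paths that survive few faults. -/

section monotone

variable {n : ℕ} {F : Finset (hypercube n).Subgraph} {u v : Fin n → Bool} {i : Fin n}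

lemma mem_faultsMeeting {H : (hypercube n).Subgraph} :
    H ∈ faultsMeeting F u v ↔ H ∈ F ∧ ∃ w ∈ H.verts, w ∈ subcube u v := by
  simp [faultsMeeting]

lemma card_faultsMeeting_le : (faultsMeeting F u v).card ≤ F.card := by
  classical exact Finset.card_filter_le _ _

lemma faultsMeeting_bitFlip_subset (h : u i ≠ v i) :
    faultsMeeting F (bitFlip u i) v ⊆ faultsMeeting F u v := by
  intro H hH
  rw [mem_faultsMeeting] at hH ⊢
  obtain ⟨hF, w, hw, hwu⟩ := hH
  exact ⟨hF, w, hw, subcube_bitFlip_subset h hwu⟩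

lemma card_faultsMeeting_bitFlip_lt (h : u i ≠ v i) {H : (hypercube n).Subgraph}
    (hH : H ∈ faultsMeeting F u v) (hH' : ∀ w ∈ H.verts, w ∈ subcube u v → w i ≠ v i) :
    (faultsMeeting F (bitFlip u i) v).card < (faultsMeeting F u v).card := by
  refine Finset.card_lt_card ⟨faultsMeeting_bitFlip_subset h, fun hs => ?_⟩
  obtain ⟨-, w, hw, hwu⟩ := mem_faultsMeeting.1 (hs hH)
  rw [mem_subcube_bitFlip h] at hwu
  exact hH' w hw hwu.1 hwu.2

lemma exists_ne_of_mem_survivors (hv : v ∈ survivors F) {H : (hypercube n).Subgraph}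
    (hH : H ∈ F) {w : Fin n → Bool} (hw : w ∈ H.verts) : ∃ i, w i ≠ v i := by
  by_contra! hc
  exact hv H hH (funext hc ▸ hw)

lemma edist_bitFlip_le (hu : u ∈ survivors F) (hu' : bitFlip u i ∈ survivors F)
    (z : survivors F) :
    ((hypercube n).removeFamily F).edist ⟨u, hu⟩ z ≤
      1 + ((hypercube n).removeFamily F).edist ⟨bitFlip u i, hu'⟩ z := by
  refine SimpleGraph.edist_triangle.trans (add_le_add_left (le_of_eq ?_) _)
  rw [edist_eq_one_iff_adj]
  exact hammingDist_bitFlip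

open scoped Classical in
/-- Each fault kills at most one neighbour of `u` in the subcube spanned by `u` and `v`. -/
lemma card_killed_le (hF : IsCliqueFamily F) :
    (Finset.univ.filter fun i => u i ≠ v i ∧ ∃ H ∈ F, bitFlip u i ∈ H.verts).card ≤
      (faultsMeeting F u v).card := by
  refine Finset.card_le_card_of_forall_subsingleton (fun i H => bitFlip u i ∈ SimpleGraph.Subgraph.verts H) ?_ ?_
  · intro i hi
    simp only [Finset.mem_filter, Finset.mem_univ, true_and] at hi
    obtain ⟨hi, H, hH, hm⟩ := hi
    exact ⟨H, mem_faultsMeeting.2 ⟨hH, _, hm, bitFlip_mem_subcube hi⟩, hm⟩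
  · rintro H hH i ⟨-, hi⟩ j ⟨-, hj⟩
    by_contra hij
    have := hF H (mem_faultsMeeting.1 hH).1 _ hi _ hj
    exact hij (eq_of_hammingDist_le_one this (by simp [bitFlip_of_ne hij])
      (by simp [bitFlip_of_ne (Ne.symm hij)]))

open scoped Classical in
/-- There are many surviving neighbours of `u` in the subcube spanned by `u` and `v`. -/
lemma hammingDist_le_card_add (hF : IsCliqueFamily F) :
    hammingDist u v ≤ (Finset.univ.filter fun i => u i ≠ v i ∧ bitFlip u i ∈ survivors F).card +
      (faultsMeeting F u v).card := by
  refine le_trans ?_ (add_le_add_right (card_killed_le hF) _)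
  rw [hammingDist]
  refine le_trans (Finset.card_le_card fun i hi => ?_) (Finset.card_union_le _ _)
  have hi' := (Finset.mem_filter.1 hi).2
  refine Finset.mem_union.2 ?_
  by_cases h : ∃ H ∈ F, bitFlip u i ∈ H.verts
  · exact Or.inr (Finset.mem_filter.2 ⟨Finset.mem_univ _, hi', h⟩)
  · exact Or.inl (Finset.mem_filter.2 ⟨Finset.mem_univ _, hi', fun H hH hm => h ⟨H, hH, hm⟩⟩)

/-- One step towards `v` which discards a fault, when faults are single vertices of the subcube. -/
lemma exists_step_of_subsingleton (hF : IsCliqueFamily F) (hv : v ∈ survivors F)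
    (hs : ∀ H ∈ F, (H.verts ∩ subcube u v).Subsingleton)
    (hcard : (faultsMeeting F u v).card < hammingDist u v) :
    ∃ i, u i ≠ v i ∧ bitFlip u i ∈ survivors F ∧
      (faultsMeeting F (bitFlip u i) v).card ≤ (faultsMeeting F u v).card - 1 := by
  classical
  have h1 := hammingDist_le_card_add (u := u) (v := v) hF
  obtain ⟨i, hi⟩ := Finset.card_pos.1 (show 0 < (Finset.univ.filter fun i => u i ≠ v i ∧
    bitFlip u i ∈ survivors F).card by omega)
  simp only [Finset.mem_filter, Finset.mem_univ, true_and] at hi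
  rcases (faultsMeeting F u v).eq_empty_or_nonempty with he | ⟨A, hA⟩
  · refine ⟨i, hi.1, hi.2, ?_⟩
    have := Finset.card_le_card (faultsMeeting_bitFlip_subset (F := F) hi.1)
    rw [he] at this ⊢
    simpa using this
  -- If direction `i` discards no fault, every fault has its only subcube vertex in the half
  -- containing `v`. Then a direction separating the vertex of `A` from `v` discards `A`, and it is
  -- not blocked, because the neighbour of `u` it leads to lies in the other half.
  by_cases hall : ∀ H ∈ faultsMeeting F u v, ∃ w ∈ H.verts, w ∈ subcube u v ∧ w i = v i
  · obtain ⟨hAF, w, hw, hwu⟩ := mem_faultsMeeting.1 hA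
    obtain ⟨j, hj⟩ := exists_ne_of_mem_survivors hv hAF hw
    have hji : j ≠ i := by
      rintro rfl
      obtain ⟨w', hw', hwu', h'⟩ := hall A hA
      exact hj (hs A hAF ⟨hw, hwu⟩ ⟨hw', hwu'⟩ ▸ h')
    have huj : u j ≠ v j := fun h => hj (by rw [hwu j h, h])
    refine ⟨j, huj, fun H hH hm => ?_, Nat.le_sub_one_of_lt
      (card_faultsMeeting_bitFlip_lt huj hA fun w' hw' hwu' => ?_)⟩
    · have hmu := bitFlip_mem_subcube huj
      obtain ⟨w', hw', hwu', h'⟩ := hall H (mem_faultsMeeting.2 ⟨hH, _, hm, hmu⟩)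
      have := hs H hH ⟨hm, hmu⟩ ⟨hw', hwu'⟩
      rw [← this, bitFlip_of_ne hji.symm] at h'
      exact hi.1 h'
    · exact hs A hAF ⟨hw, hwu⟩ ⟨hw', hwu'⟩ ▸ hj
  · push Not at hall
    obtain ⟨H, hH, hm⟩ := hall
    exact ⟨i, hi.1, hi.2, Nat.le_sub_one_of_lt (card_faultsMeeting_bitFlip_lt hi.1 hH hm)⟩

/-- One step towards `v` which discards a fault. -/
lemma exists_step (hF : IsCliqueFamily F) (hv : v ∈ survivors F) (hne : u ≠ v)
    (hcard : (faultsMeeting F u v).card ≤ hammingDist u v - 2) :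
    ∃ i, u i ≠ v i ∧ bitFlip u i ∈ survivors F ∧
      (faultsMeeting F (bitFlip u i) v).card ≤ (faultsMeeting F u v).card - 1 := by
  classical
  have h1 := hammingDist_le_card_add (u := u) (v := v) hF
  have h0 : 0 < hammingDist u v := hammingDist_pos.2 hne
  rcases (faultsMeeting F u v).eq_empty_or_nonempty with he | ⟨A, hA⟩
  · obtain ⟨i, hi⟩ := Finset.card_pos.1 (show 0 < (Finset.univ.filter fun i => u i ≠ v i ∧
      bitFlip u i ∈ survivors F).card by rw [he, Finset.card_empty] at h1; omega)
    simp only [Finset.mem_filter, Finset.mem_univ, true_and] at hi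
    refine ⟨i, hi.1, hi.2, ?_⟩
    have := Finset.card_le_card (faultsMeeting_bitFlip_subset (F := F) hi.1)
    rw [he] at this ⊢
    simpa using this
  have hApos := Finset.card_pos.2 ⟨A, hA⟩
  -- A fault is present, so truncation plays no role in the bound d - 2, and two directions survive.
  obtain ⟨i, hi, k, hk, hik⟩ := Finset.one_lt_card.1 (show 1 < (Finset.univ.filter fun i =>
    u i ≠ v i ∧ bitFlip u i ∈ survivors F).card by omega)
  simp only [Finset.mem_filter, Finset.mem_univ, true_and] at hi hk
  by_contra! hcon
  have key : ∀ j, u j ≠ v j → bitFlip u j ∈ survivors F → ∀ H ∈ faultsMeeting F u v,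
      ∃ w ∈ H.verts, w ∈ subcube u v ∧ w j = v j := by
    intro j hj hjs H hH
    by_contra! hc
    have := card_faultsMeeting_bitFlip_lt hj hH hc
    have := hcon j hj hjs
    omega
  -- A fault containing a neighbour of `u` would have to reach the far halves in both directions `i`
  -- and `k`; the two vertices doing so would differ in both coordinates.
  have hsurv : ∀ j, u j ≠ v j → bitFlip u j ∈ survivors F := by
    intro j hj H hH hm
    have hHm : H ∈ faultsMeeting F u v :=
      mem_faultsMeeting.2 ⟨hH, _, hm, bitFlip_mem_subcube hj⟩
    obtain ⟨y, hy, -, hyi⟩ := key i hi.1 hi.2 H hHm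
    obtain ⟨z, hz, -, hzk⟩ := key k hk.1 hk.2 H hHm
    have hji : i ≠ j := by rintro rfl; exact hi.2 H hH hm
    have hjk : k ≠ j := by rintro rfl; exact hk.2 H hH hm
    have e1 := @eq_of_hammingDist_le_one _ _ _ i k (hF H hH _ hm _ hy)
    have e2 := @eq_of_hammingDist_le_one _ _ _ k i (hF H hH _ hm _ hz)
    have e3 := @eq_of_hammingDist_le_one _ _ _ i k (hF H hH _ hy _ hz)
    have b1 := bitFlip_of_ne (u := u) hji
    have b2 := bitFlip_of_ne (u := u) hjk
    grind
  obtain ⟨hAF, x, hx, hxu⟩ := mem_faultsMeeting.1 hA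
  have hD : ∀ w ∈ subcube u v, ∀ j, w j ≠ v j → u j ≠ v j := fun w hw j hj h =>
    hj (by rw [hw j h, h])
  -- Now `A` reaches the far half in every direction. Then `x` and `y` differ only at `a`, so `z`,
  -- which differs from both at `b`, would agree with both at `a`.
  obtain ⟨a, ha⟩ := exists_ne_of_mem_survivors hv hAF hx
  have hua := hD x hxu a ha
  obtain ⟨y, hy, hyu, hya⟩ := key a hua (hsurv a hua) A hA
  obtain ⟨b, hb⟩ := exists_ne_of_mem_survivors hv hAF hy
  have hub := hD y hyu b hb
  obtain ⟨z, hz, hzu, hzb⟩ := key b hub (hsurv b hub) A hA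
  have e1 := @eq_of_hammingDist_le_one _ _ _ a b (hF A hAF _ hx _ hy)
  have e2 := @eq_of_hammingDist_le_one _ _ _ a b (hF A hAF _ hx _ hz)
  have e3 := @eq_of_hammingDist_le_one _ _ _ a b (hF A hAF _ hy _ hz)
  grind

/-- A shortest path of the hypercube survives if few enough faults meet the subcube. -/
theorem edist_le_hammingDist (hF : IsCliqueFamily F) (hu : u ∈ survivors F)
    (hv : v ∈ survivors F) (hcard : (faultsMeeting F u v).card ≤ hammingDist u v - 2) :
    ((hypercube n).removeFamily F).edist ⟨u, hu⟩ ⟨v, hv⟩ ≤ hammingDist u v := by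
  induction hd : hammingDist u v generalizing u with
  | zero =>
    obtain rfl := hammingDist_eq_zero.1 hd
    simp
  | succ d ih =>
    have hne : u ≠ v := hammingDist_pos.1 (by omega)
    obtain ⟨i, hi, his, hic⟩ := exists_step hF hv hne hcard
    have hdi := hammingDist_bitFlip_of_ne hi
    refine (edist_bitFlip_le hu his _).trans ?_
    rw [Nat.cast_succ, add_comm]
    exact add_le_add_left (ih his (by omega) (by omega)) _

/-- A shortest path of the hypercube survives if there are fewer faults meeting the subcube than
its dimension, and each of them meets it in at most one vertex. -/
theorem edist_le_hammingDist_of_subsingleton (hF : IsCliqueFamily F) (hu : u ∈ survivors F)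
    (hv : v ∈ survivors F) (hs : ∀ H ∈ F, (H.verts ∩ subcube u v).Subsingleton)
    (hcard : (faultsMeeting F u v).card ≤ hammingDist u v - 1) :
    ((hypercube n).removeFamily F).edist ⟨u, hu⟩ ⟨v, hv⟩ ≤ hammingDist u v := by
  induction hd : hammingDist u v generalizing u with
  | zero =>
    obtain rfl := hammingDist_eq_zero.1 hd
    simp
  | succ d ih =>
    obtain ⟨i, hi, his, hic⟩ := exists_step_of_subsingleton hF hv hs (by omega)
    have hdi := hammingDist_bitFlip_of_ne hi
    refine (edist_bitFlip_le hu his _).trans ?_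
    rw [Nat.cast_succ, add_comm]
    refine add_le_add_left (ih his (fun H hH => (hs H hH).anti ?_) (by omega) (by omega)) _
    exact Set.inter_subset_inter_right _ (subcube_bitFlip_subset hi)

end monotone

/-! ### Detours through translated subcubes, and the upper bounds. -/

section detour

variable {n : ℕ} {F : Finset (hypercube n).Subgraph} {u v : Fin n → Bool} {i : Fin n}

lemma card_agree_add_hammingDist (u v : Fin n → Bool) :
    (Finset.univ.filter fun i => u i = v i).card + hammingDist u v = n := by
  have := Finset.card_filter_add_card_filter_not (s := (Finset.univ : Finset (Fin n)))
    (fun i => u i = v i)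
  simpa [hammingDist] using this

/-- If every fault meeting the translate of the subcube spanned by `u` and `v` in direction `i`
also meets that subcube, then the endpoints of the translate survive. -/
lemma bitFlip_mem_survivors (hF : IsCliqueFamily F) (hu : u ∈ survivors F) (hi : u i = v i)
    (hZ : ∀ H ∈ F, (∃ w ∈ H.verts, w ∈ subcube (bitFlip u i) (bitFlip v i)) →
      ∃ w ∈ H.verts, w ∈ subcube u v) : bitFlip u i ∈ survivors F := by
  intro H hH hm
  obtain ⟨w, hw, hwu⟩ := hZ H hH ⟨_, hm, left_mem_subcube⟩
  have hwi := hwu i hi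
  have : w = u := by
    funext j
    by_contra hj
    have hji : j ≠ i := by rintro rfl; exact hj hwi
    have := @eq_of_hammingDist_le_one _ _ _ j i (hF H hH _ hm _ hw)
      (by rw [bitFlip_of_ne hji]; exact fun h => hj h.symm) (by simp [hwi])
    exact hji this
  exact hu H hH (this ▸ hw)

lemma subcube_comm (u v : Fin n → Bool) : subcube u v = subcube v u := by
  ext w
  exact ⟨fun h i hi => by rw [h i hi.symm, hi], fun h i hi => by rw [h i hi.symm, hi]⟩

/-- A fault cannot meet the translates of a subcube in two different directions. -/
lemma eq_of_mem_translates (hF : IsCliqueFamily F) {H : (hypercube n).Subgraph} (hH : H ∈ F)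
    {j : Fin n} (hi : u i = v i) (hj : u j = v j)
    (h1 : ∃ w ∈ H.verts, w ∈ subcube (bitFlip u i) (bitFlip v i))
    (h2 : ∃ w ∈ H.verts, w ∈ subcube (bitFlip u j) (bitFlip v j)) : i = j := by
  obtain ⟨x, hx, hxi⟩ := h1
  obtain ⟨y, hy, hyj⟩ := h2
  rw [mem_subcube_bitFlip_bitFlip hi] at hxi
  rw [mem_subcube_bitFlip_bitFlip hj] at hyj
  by_contra hij
  refine hij (eq_of_hammingDist_le_one (hF H hH _ hx _ hy) ?_ ?_)
  · rw [hyj.2 i hij hi]; exact hxi.1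
  · rw [hxi.2 j (Ne.symm hij) hj]; exact hyj.1.symm

/-- The route through the translate in direction `i`. -/
lemma edist_le_of_translate (hF : IsCliqueFamily F) (hu : u ∈ survivors F) (hv : v ∈ survivors F)
    (hi : u i = v i)
    (hZ : ∀ H ∈ F, (∃ w ∈ H.verts, w ∈ subcube (bitFlip u i) (bitFlip v i)) →
      ∃ w ∈ H.verts, w ∈ subcube u v)
    (hcard : (faultsMeeting F (bitFlip u i) (bitFlip v i)).card ≤ hammingDist u v - 1) :
    ((hypercube n).removeFamily F).edist ⟨u, hu⟩ ⟨v, hv⟩ ≤ hammingDist u v + 2 := by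
  have hu' := bitFlip_mem_survivors hF hu hi hZ
  have hv' : bitFlip v i ∈ survivors F := by
    refine bitFlip_mem_survivors (v := u) hF hv hi.symm ?_
    rwa [subcube_comm v u, subcube_comm (bitFlip v i)]
  -- A fault meeting both the translate and the subcube is an edge in direction `i`, hence has one
  -- vertex in the translate; this permits the weaker bound d - 1.
  have hmid := edist_le_hammingDist_of_subsingleton hF hu' hv' (fun H hH x hx y hy => by
    obtain ⟨w, hw, hwu⟩ := hZ H hH ⟨x, hx⟩
    have hx2 := (mem_subcube_bitFlip_bitFlip hi).1 hx.2
    have hy2 := (mem_subcube_bitFlip_bitFlip hi).1 hy.2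
    have hwi := hwu i hi
    funext j
    by_cases hj : j = i
    · subst hj
      have := hx2.1; have := hy2.1
      cases hxj : x j <;> cases hyj : y j <;> simp_all
    · have e1 := @eq_of_hammingDist_le_one _ _ _ j i (hF H hH _ hx.1 _ hw)
      have e2 := @eq_of_hammingDist_le_one _ _ _ j i (hF H hH _ hy.1 _ hw)
      have := hx2.1; have := hy2.1
      grind) (by rwa [hammingDist_bitFlip_bitFlip])
  rw [hammingDist_bitFlip_bitFlip] at hmid
  refine (edist_bitFlip_le hu hu' _).trans ?_
  rw [edist_comm]
  refine (add_le_add_right (edist_bitFlip_le hv hv' _) _).trans ?_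
  rw [edist_comm]
  refine (add_le_add_right (add_le_add_right hmid _) _).trans (le_of_eq ?_)
  rw [← add_assoc, add_comm]
  norm_num

open scoped Classical in
/-- Either some detour is available or the shortest paths are not all blocked. -/
lemma exists_translate (hF : IsCliqueFamily F) (hcard : F.card ≤ n - 2)
    (hd2 : 2 ≤ hammingDist u v)
    (hblock : hammingDist u v - 2 < (faultsMeeting F u v).card) :
    ∃ i, u i = v i ∧ (∀ H ∈ F, (∃ w ∈ H.verts, w ∈ subcube (bitFlip u i) (bitFlip v i)) →
      ∃ w ∈ H.verts, w ∈ subcube u v) ∧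
      (faultsMeeting F (bitFlip u i) (bitFlip v i)).card ≤ hammingDist u v - 1 := by
  set d := hammingDist u v
  let C : Finset (Fin n) := Finset.univ.filter fun i => u i = v i
  let meets : Fin n → (hypercube n).Subgraph → Prop :=
    fun i H => ∃ w ∈ H.verts, w ∈ subcube (bitFlip u i) (bitFlip v i)
  let O := F.filter fun H => ¬ ∃ w ∈ H.verts, w ∈ subcube u v
  let Z := C.filter fun i => ∀ H ∈ O, ¬ meets i H
  have hC : C.card + d = n := card_agree_add_hammingDist u v
  have hO : (faultsMeeting F u v).card + O.card = F.card :=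
    Finset.card_filter_add_card_filter_not _
  have hmem : ∀ i ∈ Z, ∀ H ∈ F, meets i H → ∃ w ∈ H.verts, w ∈ subcube u v := by
    intro i hi H hH hm
    by_contra hc
    exact (Finset.mem_filter.1 hi).2 H (Finset.mem_filter.2 ⟨hH, hc⟩) hm
  have hZ : C.card ≤ Z.card + O.card := by
    have h1 : (C.filter fun i => ¬ ∀ H ∈ O, ¬ meets i H).card ≤ O.card := by
      refine Finset.card_le_card_of_forall_subsingleton meets ?_ ?_
      · intro i hi
        have := (Finset.mem_filter.1 hi).2
        push Not at this
        exact this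
      · rintro H hH i ⟨hi, hi'⟩ j ⟨hj, hj'⟩
        simp only [C, Finset.mem_filter, Finset.mem_univ, true_and] at hi hj
        exact eq_of_mem_translates hF (Finset.mem_filter.1 hH).1 hi.1 hj.1 hi' hj'
    have h2 : Z.card + _ = C.card := Finset.card_filter_add_card_filter_not _
    omega
  by_contra! hcon
  -- If every direction in `Z` fails, each such translate meets at least d faults, all meeting the
  -- subcube, while a fault meets at most one translate. With m faults meeting the subcube, |Z| d ≤
  -- m ≤ |Z| + d - 2, that is (|Z| - 1)(d - 1) < 0, impossible since |Z| ≥ 1.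
  have hcount : Z.card * d ≤ (faultsMeeting F u v).card * 1 := by
    refine Finset.card_mul_le_card_mul meets ?_ ?_
    · intro i hi
      have hi' : u i = v i := by simpa [C] using (Finset.mem_filter.1 hi).1
      have := hcon i hi' (hmem i hi)
      refine le_trans (by omega) (Finset.card_le_card (s :=
        faultsMeeting F (bitFlip u i) (bitFlip v i)) fun H hH => ?_)
      rw [mem_faultsMeeting] at hH
      rw [Finset.mem_bipartiteAbove, mem_faultsMeeting]
      exact ⟨⟨hH.1, hmem i hi H hH.1 hH.2⟩, hH.2⟩
    · intro H hH
      refine Finset.card_le_one.2 fun i hi j hj => ?_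
      rw [Finset.mem_bipartiteBelow] at hi hj
      have hi' : u i = v i := by simpa [C] using (Finset.mem_filter.1 hi.1).1
      have hj' : u j = v j := by simpa [C] using (Finset.mem_filter.1 hj.1).1
      exact eq_of_mem_translates hF (mem_faultsMeeting.1 hH).1 hi' hj' hi.2 hj.2
  obtain ⟨t, ht⟩ : ∃ t, Z.card = t + 1 := ⟨Z.card - 1, by omega⟩
  obtain ⟨e, he⟩ : ∃ e, d = e + 2 := ⟨d - 2, by omega⟩
  rw [ht, he] at hcount
  have : (t + 1) * (e + 2) = t * e + 2 * t + e + 2 := by ring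
  have : 0 ≤ t * e := Nat.zero_le _
  omega

/-- Distances after removing at most `n - 2` vertices and edges from the hypercube. -/
theorem edist_le_hammingDist_add_two (hF : IsCliqueFamily F) (hcard : F.card ≤ n - 2)
    (hu : u ∈ survivors F) (hv : v ∈ survivors F) :
    ((hypercube n).removeFamily F).edist ⟨u, hu⟩ ⟨v, hv⟩ ≤ hammingDist u v + 2 := by
  by_cases hblock : (faultsMeeting F u v).card ≤ hammingDist u v - 2
  · exact (edist_le_hammingDist hF hu hv hblock).trans le_self_add
  rcases Nat.lt_or_ge (hammingDist u v) 2 with h2 | h2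
  · have h3 : ((hypercube n).removeFamily F).edist ⟨u, hu⟩ ⟨v, hv⟩ ≤ 1 := by
      rcases Nat.lt_or_ge (hammingDist u v) 1 with h1 | h1
      · obtain rfl := hammingDist_eq_zero.1 (Nat.lt_one_iff.1 h1)
        simp
      · refine le_of_eq (edist_eq_one_iff_adj.2 ?_)
        exact le_antisymm (Nat.le_of_lt_succ h2) h1
    exact h3.trans (le_add_left (by norm_num))
  · obtain ⟨i, hi, hZ, hc⟩ := exists_translate hF hcard h2 (not_le.1 hblock)
    exact edist_le_of_translate hF hu hv hi hZ hc

/-- An antipodal pair spans the whole cube, so the total n - 2 is already the d - 2 that shortest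
paths tolerate. -/
theorem edist_le_of_hammingDist_eq (hF : IsCliqueFamily F) (hcard : F.card ≤ n - 2)
    (hu : u ∈ survivors F) (hv : v ∈ survivors F) (hd : hammingDist u v = n) :
    ((hypercube n).removeFamily F).edist ⟨u, hu⟩ ⟨v, hv⟩ ≤ n := by
  have := edist_le_hammingDist hF hu hv (by
    rw [hd]; exact card_faultsMeeting_le.trans hcard)
  rwa [hd] at this

lemma hammingDist_le_dim (u v : Fin n → Bool) : hammingDist u v ≤ n := by
  simpa using hammingDist_le_card_fintype (x := u) (y := v)

theorem ediam_removeFamily_le (hF : IsCliqueFamily F) (hcard : F.card ≤ n - 2) :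
    ((hypercube n).removeFamily F).ediam ≤ n + 1 := by
  refine ediam_le_of_edist_le fun u v => ?_
  rcases (hammingDist_le_dim u.1 v.1).eq_or_lt with h | h
  · exact (edist_le_of_hammingDist_eq hF hcard u.2 v.2 h).trans le_self_add
  · refine (edist_le_hammingDist_add_two hF hcard u.2 v.2).trans ?_
    exact_mod_cast Nat.add_le_add_right (Nat.succ_le_of_lt h) 1

/-- A fault meets a two-dimensional subcube with surviving opposite corners at most once. -/
lemma subsingleton_inter_subcube (hF : IsCliqueFamily F) (hu : u ∈ survivors F)
    (hv : v ∈ survivors F) (hd : hammingDist u v = 2) {H : (hypercube n).Subgraph} (hH : H ∈ F) :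
    (H.verts ∩ subcube u v).Subsingleton := by
  obtain ⟨a, b, hab, hD⟩ := Finset.card_eq_two.1 hd
  have hD' : ∀ k, u k ≠ v k ↔ k = a ∨ k = b := fun k => by
    simpa using Finset.ext_iff.1 hD k
  have hB : ∀ p q r : Bool, p ≠ r → q ≠ r → p = q := by decide
  -- The vertices of the 4-cycle other than `u` and `v` are opposite, hence not adjacent.
  have hmid : ∀ x ∈ H.verts, x ∈ subcube u v → (x a = u a ↔ x b = v b) := by
    intro x hx hxu
    have h1 : x ≠ u := by rintro rfl; exact hu H hH hx
    have h2 : x ≠ v := by rintro rfl; exact hv H hH hx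
    obtain ⟨i, hi⟩ := Function.ne_iff.1 h1
    obtain ⟨j, hj⟩ := Function.ne_iff.1 h2
    have := hxu i; have := hxu j
    have := hB (x i) (v i) (u i); have := hB (x j) (u j) (v j)
    have := hD' i; have := hD' j; have := hD' a; have := hD' b
    grind
  rintro x ⟨hx, hxu⟩ y ⟨hy, hyu⟩
  have hx' := hmid x hx hxu
  have hy' := hmid y hy hyu
  have e := @eq_of_hammingDist_le_one _ _ _ a b (hF H hH _ hx _ hy)
  have := hD' a; have := hD' b
  have := hB (x a) (y a) (u a); have := hB (x b) (y b) (v b)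
  funext k
  have := hxu k; have := hyu k; have := hD' k
  grind

/-- Only distance 2 escapes the general bounds; there the single fault removes at most one of the
two middle vertices. -/
theorem ediam_removeFamily_three_le {F : Finset (hypercube 3).Subgraph} (hF : IsCliqueFamily F)
    (hcard : F.card ≤ 1) : ((hypercube 3).removeFamily F).ediam ≤ 3 := by
  refine ediam_le_of_edist_le fun u v => ?_
  have hle := hammingDist_le_dim u.1 v.1
  rcases hle.eq_or_lt with h | h
  · exact edist_le_of_hammingDist_eq hF hcard u.2 v.2 h
  rcases Nat.lt_or_ge (hammingDist u.1 v.1) 2 with h2 | h2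
  · refine (edist_le_hammingDist_add_two hF hcard u.2 v.2).trans ?_
    exact_mod_cast Nat.add_le_add_right (Nat.le_of_lt_succ h2) 2
  · have h2' : hammingDist u.1 v.1 = 2 := by omega
    refine (edist_le_hammingDist_of_subsingleton hF u.2 v.2
      (fun H hH => subsingleton_inter_subcube hF u.2 v.2 h2' hH) ?_).trans ?_
    · rw [h2']; exact card_faultsMeeting_le.trans hcard
    · exact_mod_cast hle

end detour

/-! ### Structures and substructures of the single edge. -/

section structures

lemma hypercube_one_eq_top : hypercube 1 = ⊤ := by
  ext x y
  refine ⟨fun h => h.ne, fun h => ?_⟩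
  refine le_antisymm (hammingDist_le_dim x y) (hammingDist_pos.2 h)

lemma hypercube_one_connected : (hypercube 1).Connected :=
  hypercube_one_eq_top ▸ connected_top

lemma SimpleGraph.IsStructure.isSubstructure {V U : Type*} {W : SimpleGraph U}
    (hW : W.Connected) {G : SimpleGraph V} {H : G.Subgraph} (h : IsStructure W H) :
    IsSubstructure W H := by
  obtain ⟨e⟩ := h
  refine ⟨⊤, ?_, ⟨e.trans Subgraph.topIso.symm⟩⟩
  exact ⟨Subgraph.topIso.connected_iff.2 hW⟩

lemma hammingDist_le_one_of_isSubstructure {n : ℕ} {H : (hypercube n).Subgraph}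
    (h : IsSubstructure (hypercube 1) H) {x y : Fin n → Bool} (hx : x ∈ H.verts)
    (hy : y ∈ H.verts) : hammingDist x y ≤ 1 := by
  obtain ⟨W', hW', ⟨e⟩⟩ := h
  by_cases hxy : x = y
  · simp [hxy]
  have hne : e ⟨x, hx⟩ ≠ e ⟨y, hy⟩ := fun h => hxy (Subtype.ext_iff.1 (e.injective h))
  have : Nontrivial W'.verts := ⟨_, _, hne⟩
  obtain ⟨c, hc⟩ := hW'.preconnected.coe.exists_adj_of_nontrivial (e ⟨x, hx⟩)
  have hcy : c = e ⟨y, hy⟩ := by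
    have h1 : (e ⟨x, hx⟩).1 ≠ c.1 := fun h => hc.ne (Subtype.ext h)
    have h2 : (e ⟨x, hx⟩).1 ≠ (e ⟨y, hy⟩).1 := fun h => hne (Subtype.ext h)
    generalize (e ⟨x, hx⟩).1 = p at h1 h2
    refine Subtype.ext (funext fun i => ?_)
    have key : ∀ a b : Fin 1 → Bool, a ≠ b → a i ≠ b i := fun a b hab h =>
      hab (funext fun j => by rwa [Subsingleton.elim j i])
    have hB : ∀ p q r : Bool, p ≠ q → p ≠ r → q = r := by decide
    exact hB _ _ _ (key _ _ h1) (key _ _ h2)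
  rw [hcy, e.map_adj_iff] at hc
  exact le_of_eq (H.adj_sub hc)

lemma isStructure_subgraphOfAdj {V : Type*} {G : SimpleGraph V} {a b : V} (h : G.Adj a b) :
    IsStructure (hypercube 1) (G.subgraphOfAdj h) := by
  have htop : (G.subgraphOfAdj h).coe = ⊤ := by
    ext ⟨x, hx⟩ ⟨y, hy⟩
    simp only [subgraphOfAdj_verts, Set.mem_insert_iff, Set.mem_singleton_iff] at hx hy
    have := h.ne
    rcases hx with rfl | rfl <;> rcases hy with rfl | rfl <;>
      simp [Subgraph.coe_adj, this, this.symm, Sym2.eq_swap]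
  have hcard : Nat.card (G.subgraphOfAdj h).verts = Nat.card (Fin 1 → Bool) := by
    rw [Nat.card_coe_set_eq, subgraphOfAdj_verts, Set.ncard_pair h.ne]
    simp
  have : Finite (G.subgraphOfAdj h).verts :=
    Set.toFinite (({a, b} : Set V))
  rw [IsStructure, htop, hypercube_one_eq_top]
  exact ⟨Iso.completeGraph ((Finite.equivFinOfCardEq hcard).trans (Finite.equivFin _).symm)⟩

end structures

/-! ### Extremal fault families of parallel edges. -/

section edgeFamily

variable {n : ℕ} {o : Fin n} {T : Finset (Fin n)}

/-- The all-zero bit string. -/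
def zeroString (n : ℕ) : Fin n → Bool := fun _ => false

/-- The edge in direction `o` at the string whose only nonzero bit is the `i`-th one. -/
def edgeFault (o i : Fin n) : (hypercube n).Subgraph :=
  (hypercube n).subgraphOfAdj (v := bitFlip (zeroString n) i)
    (w := bitFlip (bitFlip (zeroString n) i) o) hammingDist_bitFlip

open scoped Classical in
/-- The edges in direction `o` at the strings whose only nonzero bit lies in `T`. -/
noncomputable def edgeFamily (o : Fin n) (T : Finset (Fin n)) : Finset (hypercube n).Subgraph :=
  T.image (edgeFault o)

/-- The criterion ignores coordinate `o`: modulo direction `o`, the fault is one neighbour of the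
origin in a cube of dimension n - 1. -/
lemma mem_edgeFault {i : Fin n} (hi : i ≠ o) {x : Fin n → Bool} :
    x ∈ (edgeFault o i).verts ↔ ∀ j, j ≠ o → (x j = true ↔ j = i) := by
  change x = _ ∨ x = _ ↔ _
  constructor
  · rintro (rfl | rfl) j hj <;> by_cases hji : j = i <;>
      simp [bitFlip_apply, zeroString, hj, hji, hi]
  · intro h
    have hx : ∀ j, j ≠ o → x j = bitFlip (zeroString n) i j := by
      intro j hj
      have := h j hj
      by_cases hji : j = i
      · subst hji; simpa [zeroString] using this
      · simpa [bitFlip_of_ne hji, zeroString, hji] using this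
    cases ho : x o
    · left
      funext j
      by_cases hj : j = o
      · subst hj; rw [ho, bitFlip_of_ne hi.symm, zeroString]
      · exact hx j hj
    · right
      funext j
      by_cases hj : j = o
      · subst hj; rw [ho, bitFlip_self, bitFlip_of_ne hi.symm, zeroString]; rfl
      · rw [bitFlip_of_ne hj]; exact hx j hj

lemma eq_of_mem_edgeFault {i j : Fin n} (hi : i ≠ o) (hj : j ≠ o) {x : Fin n → Bool}
    (h1 : x ∈ (edgeFault o i).verts) (h2 : x ∈ (edgeFault o j).verts) : i = j :=
  ((mem_edgeFault hj).1 h2 i hi).1 (((mem_edgeFault hi).1 h1 i hi).2 rfl)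

lemma card_edgeFamily (hT : o ∉ T) : (edgeFamily o T).card = T.card := by
  classical
  refine Finset.card_image_of_injOn fun i hi j hj hij => ?_
  have h1 : bitFlip (zeroString n) i ∈ (edgeFault o i).verts := Or.inl rfl
  exact eq_of_mem_edgeFault (ne_of_mem_of_not_mem hi hT) (ne_of_mem_of_not_mem hj hT) h1
    (hij ▸ h1)

lemma isFaultFamily_edgeFamily {P : (hypercube n).Subgraph → Prop}
    (hP : ∀ H, IsStructure (hypercube 1) H → P H) (hT : o ∉ T) :
    IsFaultFamily P (edgeFamily o T) := by
  classical
  constructor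
  · intro H hH
    obtain ⟨i, -, rfl⟩ := Finset.mem_image.1 hH
    exact hP _ (isStructure_subgraphOfAdj _)
  · intro H hH K hK hne
    obtain ⟨i, hi, rfl⟩ := Finset.mem_image.1 hH
    obtain ⟨j, hj, rfl⟩ := Finset.mem_image.1 hK
    refine Set.disjoint_left.2 fun x hx hx' => hne ?_
    rw [eq_of_mem_edgeFault (ne_of_mem_of_not_mem hi hT) (ne_of_mem_of_not_mem hj hT) hx hx']

lemma mem_survivors_edgeFamily (hT : o ∉ T) {x : Fin n → Bool} :
    x ∈ survivors (edgeFamily o T) ↔ ∀ i ∈ T, ¬ ∀ j, j ≠ o → (x j = true ↔ j = i) := by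
  classical
  constructor
  · intro h i hi hx
    exact h _ (Finset.mem_image_of_mem _ hi)
      ((mem_edgeFault (ne_of_mem_of_not_mem hi hT)).2 hx)
  · intro h H hH hx
    obtain ⟨i, hi, rfl⟩ := Finset.mem_image.1 hH
    exact h i hi ((mem_edgeFault (ne_of_mem_of_not_mem hi hT)).1 hx)

lemma zeroString_mem_survivors (hT : o ∉ T) : zeroString n ∈ survivors (edgeFamily o T) := by
  rw [mem_survivors_edgeFamily hT]
  intro i hi h
  simpa [zeroString] using (h i (ne_of_mem_of_not_mem hi hT)).2 rfl

/-- An edge leaving the edge at the origin in direction `o` avoids the directions in `T`. -/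
lemma exists_direction_of_adj (hT : o ∉ T) {x y : Fin n → Bool} (hxy : hammingDist x y = 1)
    (hx : ∀ j, j ≠ o → x j = false) (hy : y ∈ survivors (edgeFamily o T))
    (hy' : ¬ ∀ j, j ≠ o → y j = false) : ∃ i, i ≠ o ∧ i ∉ T ∧ y = bitFlip x i := by
  obtain ⟨i, rfl⟩ := exists_eq_bitFlip hxy
  have hio : i ≠ o := by
    rintro rfl
    exact hy' fun j hj => by rw [bitFlip_of_ne hj, hx j hj]
  refine ⟨i, hio, fun hi => (mem_survivors_edgeFamily hT).1 hy i hi fun j hj => ?_, rfl⟩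
  by_cases hji : j = i
  · subst hji; simp [hx j hj]
  · simp [bitFlip_of_ne hji, hx j hj, hji]

lemma not_preconnected_edgeFamily (hn : 3 ≤ n) (o : Fin n) :
    ¬ ((hypercube n).removeFamily (edgeFamily o (Finset.univ.erase o))).Preconnected := by
  intro h
  have hT : o ∉ Finset.univ.erase o := Finset.notMem_erase _ _
  -- The all-ones string has at least two ones off `o` because n ≥ 3.
  have hw : (fun _ => true : Fin n → Bool) ∈
      survivors (edgeFamily o (Finset.univ.erase o)) := by
    rw [mem_survivors_edgeFamily hT]
    intro i hi hc
    obtain ⟨j, hj⟩ := Finset.exists_mem_notMem_of_card_lt_card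
      (s := {o, i}) (t := Finset.univ) (Finset.card_le_two.trans_lt (by rw [Finset.card_fin]; omega))
    have := hc j
    grind
  obtain ⟨p⟩ := h ⟨_, zeroString_mem_survivors hT⟩ ⟨_, hw⟩
  -- A walk cannot leave the edge at the origin in direction `o`, since every exit is deleted.
  have key : ∀ x y : survivors (edgeFamily o (Finset.univ.erase o)),
      ((hypercube n).removeFamily _).Walk x y →
      (∀ j, j ≠ o → x.1 j = false) → ∀ j, j ≠ o → y.1 j = false := by
    intro x y p
    induction p with
    | nil => exact id
    | cons hadj _ ih =>
      intro hx
      refine ih ?_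
      by_contra hc
      obtain ⟨i, hio, hi, -⟩ := exists_direction_of_adj hT hadj hx (Subtype.prop _) hc
      exact hi (by simp [hio])
  obtain ⟨j, hj⟩ := Finset.exists_mem_notMem_of_card_lt_card
    (s := {o}) (t := (Finset.univ : Finset (Fin n))) (by simp; omega)
  simpa using key _ _ p (fun _ _ => rfl) j (by simpa using hj.2)

/-- A function which grows by at most one along edges bounds distances from below. -/
lemma le_add_edist_of_adj {V : Type*} {G : SimpleGraph V} (f : V → ℕ)
    (hf : ∀ x y, G.Adj x y → f y ≤ f x + 1) (x y : V) : (f y : ℕ∞) ≤ f x + G.edist x y := by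
  by_cases h : G.edist x y = ⊤
  · simp [h]
  obtain ⟨p, hp⟩ := exists_walk_of_edist_ne_top h
  rw [← hp]
  norm_cast
  clear hp h
  induction p with
  | nil => simp
  | cons hadj _ ih =>
    have := hf _ _ hadj
    rw [Walk.length_cons]
    omega

open scoped Classical in
lemma le_ediam_edgeFamily (hn : 4 ≤ n) {o l : Fin n} (hlo : l ≠ o) :
    (n : ℕ∞) + 1 ≤
      ((hypercube n).removeFamily (edgeFamily o ((Finset.univ.erase o).erase l))).ediam := by
  set T := (Finset.univ.erase o).erase l
  have hT : o ∉ T := by simp [T]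
  -- The far endpoint is the antipode of the `l`-th unit string. A third index off `o`, `i`, `l`
  -- exists only for n ≥ 4; for n = 3 this string lies in the fault.
  have hy : (fun j => !bitFlip (zeroString n) l j) ∈ survivors (edgeFamily o T) := by
    rw [mem_survivors_edgeFamily hT]
    intro i hi hc
    obtain ⟨j, hj⟩ := Finset.exists_mem_notMem_of_card_lt_card
      (s := {o, i, l}) (t := Finset.univ) (Finset.card_le_three.trans_lt (by rw [Finset.card_fin]; omega))
    have := hc j
    simp only [Finset.mem_insert, Finset.mem_singleton, not_or] at hj
    rw [bitFlip_of_ne hj.2.2.2] at this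
    simp [zeroString, hj] at this
  -- A lower bound for the distance from the origin: off the edge at the origin, a path must have
  -- spent a step in direction `l`, after which distance is measured from the `l`-th unit string.
  let f : survivors (edgeFamily o T) → ℕ := fun x =>
    if ∀ j, j ≠ o → x.1 j = false then hammingDist (zeroString n) x.1
    else 1 + hammingDist (bitFlip (zeroString n) l) x.1
  have hf : ∀ x y, ((hypercube n).removeFamily (edgeFamily o T)).Adj x y → f y ≤ f x + 1 := by
    intro x y hxy
    have hxy' : hammingDist x.1 y.1 = 1 := hxy
    have ht := fun a => hammingDist_triangle a x.1 y.1
    by_cases hx : ∀ j, j ≠ o → x.1 j = false <;> by_cases hy : ∀ j, j ≠ o → y.1 j = false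
    · simp only [f, if_pos hx, if_pos hy]
      have := ht (zeroString n)
      omega
    · simp only [f, if_pos hx, if_neg hy]
      obtain ⟨i, hio, hi, he⟩ := exists_direction_of_adj hT hxy' hx y.2 hy
      obtain rfl : i = l := by simpa [T, hio] using hi
      rw [he, hammingDist_bitFlip_bitFlip]
      omega
    · simp only [f, if_neg hx, if_pos hy]
      have : hammingDist (zeroString n) y.1 ≤ 1 := by
        refine Finset.card_le_one.2 fun a ha b hb => ?_
        have h1 := hy a
        have h2 := hy b
        simp [zeroString] at ha hb
        grind
      omega
    · simp only [f, if_neg hx, if_neg hy]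
      have := ht (bitFlip (zeroString n) l)
      omega
  have := le_add_edist_of_adj f hf ⟨_, zeroString_mem_survivors hT⟩ ⟨_, hy⟩
  have h0 : f ⟨_, zeroString_mem_survivors hT⟩ = 0 := by
    simp [f, zeroString]
  have h1 : f ⟨_, hy⟩ = n + 1 := by
    have hne : ¬ ∀ j, j ≠ o → (!bitFlip (zeroString n) l j) = false := by
      intro hc
      obtain ⟨j, hj⟩ := Finset.exists_mem_notMem_of_card_lt_card
        (s := {o, l}) (t := Finset.univ) (Finset.card_le_two.trans_lt (by simp; omega))
      simp only [Finset.mem_insert, Finset.mem_singleton, not_or] at hj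
      have := hc j hj.2.1
      rw [bitFlip_of_ne hj.2.2] at this
      simp [zeroString] at this
    simp only [f, if_neg hne]
    simp [hammingDist, add_comm]
  rw [h0, h1] at this
  refine le_trans ?_ (this.trans ?_)
  · push_cast; exact le_rfl
  · rw [Nat.cast_zero, zero_add]; exact edist_le_ediam

lemma le_ediam_empty : (n : ℕ∞) ≤ ((hypercube n).removeFamily ∅).ediam := by
  have hall : ∀ x : Fin n → Bool, x ∈ survivors (∅ : Finset (hypercube n).Subgraph) := by
    intro x H hH
    simp at hH
  have := le_add_edist_of_adj (G := (hypercube n).removeFamily ∅)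
    (fun x => hammingDist (zeroString n) x.1) (fun x y hxy => by
      have hxy' : hammingDist x.1 y.1 = 1 := hxy
      have := hammingDist_triangle (zeroString n) x.1 y.1
      omega) ⟨zeroString n, hall _⟩ ⟨fun _ => true, hall _⟩
  have h1 : hammingDist (zeroString n) (fun _ => true) = n := by
    simp [hammingDist, zeroString]
  simp only [hammingDist_self, h1, Nat.cast_zero, zero_add] at this
  exact this.trans edist_le_ediam

end edgeFamily

/-! ### Assembly of connectivity and fault diameters. -/

section main

variable {n : ℕ} {P : (hypercube n).Subgraph → Prop}

lemma SimpleGraph.IsFaultFamily.isCliqueFamily {F : Finset (hypercube n).Subgraph}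
    (hP : ∀ H, P H → IsSubstructure (hypercube 1) H) (hF : IsFaultFamily P F) :
    IsCliqueFamily F :=
  fun H hH _ hx _ hy => hammingDist_le_one_of_isSubstructure (hP H (hF.1 H hH)) hx hy

/-- Any `P` between structures and substructures works: the cut consists of structures, and the
bound holds for all substructures. Both connectivities are thus covered. -/
theorem faultConnectivity_hypercube (hn : 3 ≤ n)
    (hP : ∀ H, IsStructure (hypercube 1) H → P H)
    (hP' : ∀ H, P H → IsSubstructure (hypercube 1) H) :
    (hypercube n).faultConnectivity P = ((n - 1 : ℕ) : ℕ∞) := by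
  apply le_antisymm
  · have o : Fin n := ⟨0, by omega⟩
    have hT : o ∉ Finset.univ.erase o := Finset.notMem_erase _ _
    refine sInf_le ⟨_, isFaultFamily_edgeFamily hP hT, not_preconnected_edgeFamily hn o, ?_⟩
    rw [card_edgeFamily hT, Finset.card_erase_of_mem (Finset.mem_univ _), Finset.card_fin]
  · refine le_sInf ?_
    rintro _ ⟨F, hF, hdis, rfl⟩
    by_contra! hlt
    have hlt' : F.card < n - 1 := by exact_mod_cast hlt
    have := ediam_removeFamily_le (hF.isCliqueFamily hP') (by omega)
    refine hdis (preconnected_of_ediam_ne_top fun h => ?_)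
    rw [h, top_le_iff] at this
    exact ENat.natCast_ne_top (n + 1) (by exact_mod_cast this)

lemma card_le_faultConnectivity_sub_one_iff (hn : 3 ≤ n)
    (hP : ∀ H, IsStructure (hypercube 1) H → P H)
    (hP' : ∀ H, P H → IsSubstructure (hypercube 1) H) (F : Finset (hypercube n).Subgraph) :
    (F.card : ℕ∞) ≤ (hypercube n).faultConnectivity P - 1 ↔ F.card ≤ n - 2 := by
  rw [faultConnectivity_hypercube hn hP hP']
  norm_cast

theorem faultDiameter_hypercube (hn : 4 ≤ n)
    (hP : ∀ H, IsStructure (hypercube 1) H → P H)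
    (hP' : ∀ H, P H → IsSubstructure (hypercube 1) H) :
    (hypercube n).faultDiameter P = (n : ℕ∞) + 1 := by
  classical
  have hiff := card_le_faultConnectivity_sub_one_iff (by omega : 3 ≤ n) hP hP'
  apply le_antisymm
  · refine sSup_le ?_
    rintro _ ⟨F, hF, hcard, rfl⟩
    exact ediam_removeFamily_le (hF.isCliqueFamily hP') ((hiff F).1 hcard)
  · let o : Fin n := ⟨0, by omega⟩
    let l : Fin n := ⟨1, by omega⟩
    have hlo : l ≠ o := by simp [l, o]
    have hT : o ∉ (Finset.univ.erase o).erase l := by simp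
    refine (le_ediam_edgeFamily hn hlo).trans
      (le_sSup ⟨_, isFaultFamily_edgeFamily hP hT, (hiff _).2 ?_, rfl⟩)
    rw [card_edgeFamily hT, Finset.card_erase_of_mem (by simp [hlo]),
      Finset.card_erase_of_mem (Finset.mem_univ _), Finset.card_fin]
    omega

theorem faultDiameter_hypercube_three {P : (hypercube 3).Subgraph → Prop}
    (hP : ∀ H, IsStructure (hypercube 1) H → P H)
    (hP' : ∀ H, P H → IsSubstructure (hypercube 1) H) :
    (hypercube 3).faultDiameter P = 3 := by
  have hiff := card_le_faultConnectivity_sub_one_iff le_rfl hP hP'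
  apply le_antisymm
  · refine sSup_le ?_
    rintro _ ⟨F, hF, hcard, rfl⟩
    exact ediam_removeFamily_three_le (hF.isCliqueFamily hP') ((hiff F).1 hcard)
  -- Removing nothing already gives diameter at least 3.
  · exact le_ediam_empty.trans (le_sSup ⟨∅, ⟨by simp, by simp⟩, by simp, rfl⟩)

end main

theorem theorem3p7 :
    (∀ n : ℕ, 3 ≤ n →
      (hypercube n).structureConnectivity (hypercube 1) = ((n - 1 : ℕ) : ℕ∞) ∧
      (hypercube n).substructureConnectivity (hypercube 1) = ((n - 1 : ℕ) : ℕ∞)) ∧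
    ((hypercube 3).substructureFaultDiameter (hypercube 1) = 3 ∧
      (hypercube 3).structureFaultDiameter (hypercube 1) = 3) ∧
    (∀ n : ℕ, 4 ≤ n →
      (hypercube n).substructureFaultDiameter (hypercube 1) = (n : ℕ∞) + 1 ∧
      (hypercube n).structureFaultDiameter (hypercube 1) = (n : ℕ∞) + 1) := by
  have hsub : ∀ {n : ℕ} (H : (hypercube n).Subgraph), IsStructure (hypercube 1) H →
      IsSubstructure (hypercube 1) H := fun H h => h.isSubstructure hypercube_one_connected
  exact ⟨fun n hn => ⟨faultConnectivity_hypercube hn (fun _ => id) hsub,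
      faultConnectivity_hypercube hn hsub (fun _ => id)⟩,
    ⟨faultDiameter_hypercube_three hsub (fun _ => id),
      faultDiameter_hypercube_three (fun _ => id) hsub⟩,
    fun n hn => ⟨faultDiameter_hypercube hn hsub (fun _ => id),
      faultDiameter_hypercube hn (fun _ => id) hsub⟩⟩
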